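/- Let $T:[0,1]\to[0,1]$ be a piecewise expanding map: $T$ is measurable and nonsingular with respect to Lebesgue measure $m$ (that is, $m(A)=0$ implies $m(T^{-1}A)=0$), and there are points $0=d_1<d_2<\dots<d_n=1$ such that 1. for each $i<n$, the restriction $T|_{(d_i,d_{i+1})}$ is $C^2$ and extends to a $C^2$ map on $[d_i,d_{i+1}]$; 2. $\lambda:=\inf_{x\in[0,1]\setminus\{d_1,\dots,d_n\}}T'(x)>1$; 3. $T$ is topologically mixing: for all non-empty open $U,V\subseteq[0,1]$ there is $N$ with $T^k(U)\cap V\neq\emptyset$ for all $k\ge N$. Put $$B=\frac{\sup_{x\in[0,1]\setminus\{d_1,\dots,d_n\}}\left|\frac{T''(x)}{(T'(x))^2}\right|}{\inf_{x\in[0,1]\setminus\{d_1,\dots,d_n\}}\frac1{T'(x)}}+\frac{2}{\min_{i<n}(d_{i+1}-d_i)}.$$ A physical measure of $T$ is a $T$-invariant Borel probability measure $\mu$ on $[0,1]$ for which the set of points $x$ with $\frac1k\sum_{j=0}^{k-1}\varphi(T^jx)\to\int\varphi\,d\mu$ for every bounded continuous $\varphi$ has positive Lebesgue measure. Suppose that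 $\lambda>2$, and let $f$ be the density with respect to $m$ of a physical measure of $T$. Then $$\mathrm{Var}(f)\le\frac{B}{1-2/\lambda}\qquad\text{and}\qquad\|f\|_\infty\le\frac{B}{1-2/\lambda}+1,$$ where $\mathrm{Var}(f)$ is the total variation on $[0,1]$ of $f$ as an element of $L^1$, i.e. the infimum of the total variations of the functions almost everywhere equal to $f$, and $\|f\|_\infty$ is the essential supremum norm. -/

import Mathlib

open MeasureTheory Set Filter Topology
open scoped unitInterval ENNReal BoundedContinuousFunction

noncomputable section

namespace PiecewiseExpanding

/-- A self-map `T` of `[0,1]`, seen as a function of a real variable so that it can be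
differentiated: it agrees with `T` on `[0,1]` and is constant on each side of `[0,1]`. Only its
derivatives at points of the open interval `(0,1)` are ever used. -/
def realMap (T : I → I) (x : ℝ) : ℝ := (T (projIcc 0 1 zero_le_one x) : ℝ)

/-- The set `[0,1] - {d_0, …, d_n}`. -/
def regularSet {n : ℕ} (d : Fin (n + 1) → ℝ) : Set ℝ := Icc 0 1 \ range d

/-- The constant `λ`, the infimum of `T'` over `[0,1] - {d_0, …, d_n}`. -/
def minSlope {n : ℕ} (T : I → I) (d : Fin (n + 1) → ℝ) : ℝ :=
  sInf ((fun x => deriv (realMap T) x) '' regularSet d)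

/-- Topological mixing: for all non-empty open `U`, `V`, the set `T^k(U)` meets `V` for all
sufficiently large `k`. -/
def IsTopologicallyMixing {X : Type*} [TopologicalSpace X] (T : X → X) : Prop :=
  ∀ U V : Set X, IsOpen U → IsOpen V → U.Nonempty → V.Nonempty →
    ∃ N : ℕ, ∀ k ≥ N, ((T^[k] '' U) ∩ V).Nonempty

/-- `T : [0,1] → [0,1]` is piecewise expanding with respect to the points
`0 = d_0 < d_1 < … < d_n = 1`. -/
structure IsPiecewiseExpanding {n : ℕ} (T : I → I) (d : Fin (n + 1) → ℝ) : Prop where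
  /-- `T` is measurable and nonsingular: preimages of Lebesgue null sets are null. -/
  nonsingular : Measure.QuasiMeasurePreserving T volume volume
  strictMono : StrictMono d
  first : d 0 = 0
  last : d (Fin.last n) = 1
  /-- `T` restricted to `(d_i, d_{i+1})` extends to a `C²` map on `[d_i, d_{i+1}]`; in
  particular, the restriction itself is `C²`. -/
  extends_C2 : ∀ i : Fin n, ∃ g : ℝ → ℝ,
    ContDiffOn ℝ 2 g (Icc (d i.castSucc) (d i.succ)) ∧
      EqOn g (realMap T) (Ioo (d i.castSucc) (d i.succ))
  expanding : 1 < minSlope T d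
  mixing : IsTopologicallyMixing T

/-- The constant
`B = sup |T'' / (T')²| / inf (1 / T') + 2 / min (d_{i+1} - d_i)`,
the supremum and the infimum being taken over `[0,1] - {d_0, …, d_n}`. -/
def lasotaYorkeConst {n : ℕ} (T : I → I) (d : Fin (n + 1) → ℝ) : ℝ :=
  sSup ((fun x => |deriv (deriv (realMap T)) x / (deriv (realMap T) x) ^ 2|) '' regularSet d) /
      sInf ((fun x => 1 / deriv (realMap T) x) '' regularSet d) +
    2 / ⨅ i : Fin n, (d i.succ - d i.castSucc)

/-- The basin of `μ`: the points whose Birkhoff averages converge to the `μ`-integral, for every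
bounded continuous observable. -/
def basin (T : I → I) (μ : Measure I) : Set I :=
  {x | ∀ φ : I →ᵇ ℝ,
    Tendsto (fun k : ℕ => birkhoffAverage ℝ T φ k x) atTop (𝓝 (∫ y, φ y ∂μ))}

/-- A physical measure: an invariant Borel probability measure whose basin has positive Lebesgue
measure. -/
structure IsPhysicalMeasure (T : I → I) (μ : Measure I) : Prop where
  isProbabilityMeasure : IsProbabilityMeasure μ
  invariant : MeasurePreserving T μ μ
  basin_pos : 0 < volume (basin T μ)

/-- `f` is a density of `μ` with respect to Lebesgue measure on `[0,1]`. -/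
structure IsDensity (f : I → ℝ) (μ : Measure I) : Prop where
  integrable : Integrable f volume
  nonneg : 0 ≤ᵐ[volume] f
  eq_withDensity : μ = volume.withDensity (fun x => ENNReal.ofReal (f x))

/-- The total variation on `[0,1]` of an almost everywhere class of functions: the infimum of the
pointwise total variations of the functions that are almost everywhere equal to `f`. -/
def totalVariation (f : I → ℝ) : ℝ≥0∞ :=
  ⨅ (g : I → ℝ) (_ : g =ᵐ[volume] f), eVariationOn g univ

end PiecewiseExpanding

end

/-!
Let `L` be the transfer operator of `T`, which sends the density of a measure to the density of its
image under `T`. The density `f` of an invariant measure is a fixed point of `L`, and the bounds hold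
for every fixed point of `L` that is a probability density.

The branches of `T` are increasing `C²` maps with slope at least `λ`, and the reciprocal of the slope
is `D`-Lipschitz on each of them, where `D = sup |T'' / (T')²|`. On a branch over an interval of length
at least `δ`, dividing `h` by the slope costs variation `Var h / λ + D ‖h‖₁`. Extending the result
by zero outside the image of the branch adds two jumps, which, compared with a point where `|h|` is
at most its mean, cost another `Var h / λ + 2 ‖h‖₁ / (λ δ)`. Summing over the branches gives the
Lasota–Yorke inequality `HasExpandingBranches.exists_dominatedOn_transfer`:
`Var (L h) ≤ (2 / λ) Var h + B' ‖h‖₁` with `B' = D + 2 / (λ δ)`, and `B' ≤ B` because `T' ≥ 1`.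

Since `L` does not increase `L¹` distances to `f`
(`HasExpandingBranches.integral_abs_transfer_sub_le`), one can start from polynomials close to `f`
in `L¹` and apply `L` until the factor `(2 / λ) ^ k` has made their initial variation negligible. So
`f` is an `L¹` limit of functions whose variation is at most `B' / (1 - 2 / λ)` plus an arbitrarily
small error (`HasExpandingBranches.exists_dominatedOn_near`), and lower semicontinuity of the
variation bounds `Var f` (`exists_ae_eq_dominatedOn_of_tendsto`). A function of mean `1` exceeds `1`
by at most its variation, hence the bound on the essential supremum.

Variation is handled through `DominatedOn h w s`: the increments of `h` on `s` are at most those of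
a monotone function `w`, whose total increment then bounds the variation of `h`. Sums, transport by
a branch, and the additivity over subintervals become statements about real numbers.
-/

namespace PiecewiseExpanding

/-! ### Functions dominated by a monotone function -/

/-- `h` is dominated by `w` on `s`: the increments of `h` between points of `s` are bounded by those
of `w`. Then `w` is monotone on `s`, and its total increment bounds the variation of `h` on `s`. -/
def DominatedOn {α : Type*} [LinearOrder α] (h w : α → ℝ) (s : Set α) : Prop :=
  ∀ x ∈ s, ∀ y ∈ s, x ≤ y → |h y - h x| ≤ w y - w x

theorem DominatedOn.monotoneOn {α : Type*} [LinearOrder α] {h w : α → ℝ} {s : Set α}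
    (H : DominatedOn h w s) : MonotoneOn w s := fun x hx y hy hxy =>
  sub_nonneg.1 ((abs_nonneg _).trans (H x hx y hy hxy))

theorem DominatedOn.sum {α ι : Type*} [LinearOrder α] [Fintype ι] {h w : ι → α → ℝ} {s : Set α}
    (H : ∀ i, DominatedOn (h i) (w i) s) :
    DominatedOn (fun x => ∑ i, h i x) (fun x => ∑ i, w i x) s := fun x hx y hy hxy => by
  simp only [← Finset.sum_sub_distrib]
  exact (Finset.abs_sum_le_sum_abs _ _).trans
    (Finset.sum_le_sum fun i _ => H i x hx y hy hxy)

theorem DominatedOn.eVariationOn_le {α : Type*} [LinearOrder α] {h w : α → ℝ} {s : Set α} {A B : ℝ}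
    (H : DominatedOn h w s) (hA : ∀ x ∈ s, A ≤ w x) (hB : ∀ x ∈ s, w x ≤ B) :
    eVariationOn h s ≤ ENNReal.ofReal (B - A) := by
  refine iSup_le ?_
  rintro ⟨n, u, hu, us⟩
  have hle : ∀ i, |h (u (i + 1)) - h (u i)| ≤ w (u (i + 1)) - w (u i) := fun i =>
    H _ (us i) _ (us _) (hu i.le_succ)
  calc ∑ i ∈ Finset.range n, edist (h (u (i + 1))) (h (u i))
      ≤ ∑ i ∈ Finset.range n, ENNReal.ofReal (w (u (i + 1)) - w (u i)) :=
        Finset.sum_le_sum fun i _ => by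
          rw [edist_dist, Real.dist_eq]
          exact ENNReal.ofReal_le_ofReal (hle i)
    _ = ENNReal.ofReal (w (u n) - w (u 0)) := by
        rw [← ENNReal.ofReal_sum_of_nonneg fun i _ => (abs_nonneg _).trans (hle i),
          Finset.sum_range_sub fun i => w (u i)]
    _ ≤ ENNReal.ofReal (B - A) :=
        ENNReal.ofReal_le_ofReal (sub_le_sub (hB _ (us n)) (hA _ (us 0)))

/-- A function whose variation on `E` is at most `V` agrees on `E` with a function whose variation
on the whole line order is at most `V`. -/
theorem exists_dominatedOn_univ_of_eVariationOn_le {α : Type*} [LinearOrder α] {f : α → ℝ}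
    {E : Set α} {V : ℝ} (hV : 0 ≤ V) (hf : eVariationOn f E ≤ ENNReal.ofReal V) :
    ∃ g v : α → ℝ, EqOn g f E ∧ DominatedOn g v univ ∧ ∀ x, 0 ≤ v x ∧ v x ≤ V := by
  have hfin : ∀ s ⊆ E, eVariationOn f s ≠ ∞ := fun s hs =>
    (((eVariationOn.mono f hs).trans hf).trans_lt ENNReal.ofReal_lt_top).ne
  set v : α → ℝ := fun x => (eVariationOn f (E ∩ Iic x)).toReal with hv
  have hmono : Monotone v := fun x y hxy =>
    ENNReal.toReal_mono (hfin _ inter_subset_left)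
      (eVariationOn.mono f (inter_subset_inter_right _ (Iic_subset_Iic.2 hxy)))
  have hdom : DominatedOn f v E := by
    intro x hx y hy hxy
    have h1 := eVariationOn.add_le_union f (s := E ∩ Iic x) (t := E ∩ Icc x y)
      fun a ha b hb => ha.2.trans hb.2.1
    have h2 : E ∩ Iic x ∪ E ∩ Icc x y ⊆ E ∩ Iic y := by
      rintro a (ha | ha)
      · exact ⟨ha.1, ha.2.trans hxy⟩
      · exact ⟨ha.1, ha.2.2⟩
    have h3 := h1.trans (eVariationOn.mono f h2)
    have h4 : edist (f y) (f x) ≤ eVariationOn f (E ∩ Icc x y) :=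
      eVariationOn.edist_le f ⟨hy, hxy, le_rfl⟩ ⟨hx, le_rfl, hxy⟩
    have h5 := ENNReal.toReal_mono (hfin _ inter_subset_left) ((add_le_add_right h4 _).trans h3)
    rw [ENNReal.toReal_add (hfin _ inter_subset_left) (edist_ne_top _ _), edist_dist,
      ENNReal.toReal_ofReal dist_nonneg, Real.dist_eq] at h5
    linarith
  have hdist : ∀ x ∈ E, ∀ y ∈ E, |f x - f y| ≤ |v x - v y| := by
    intro x hx y hy
    rcases le_total x y with h | h
    · rw [abs_sub_comm, abs_sub_comm (v x)]
      exact (hdom x hx y hy h).trans (le_abs_self _)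
    · exact (hdom y hy x hx h).trans (le_abs_self _)
  -- On `E` the function `f` is a `1`-Lipschitz function `F` of `v`; extend `F` to the line.
  obtain ⟨F, hF, hFf⟩ : ∃ F : ℝ → ℝ, LipschitzWith 1 F ∧ ∀ x ∈ E, F (v x) = f x := by
    rcases E.eq_empty_or_nonempty with rfl | ⟨x₀, hx₀⟩
    · exact ⟨fun _ => 0, LipschitzWith.const' 0, by simp⟩
    have : Nonempty α := ⟨x₀⟩
    have hinv : ∀ x ∈ E, Function.invFunOn v E (v x) ∈ E ∧
        v (Function.invFunOn v E (v x)) = v x := fun x hx =>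
      ⟨Function.invFunOn_mem ⟨x, hx, rfl⟩, Function.invFunOn_eq ⟨x, hx, rfl⟩⟩
    have hL : LipschitzOnWith 1 (f ∘ Function.invFunOn v E) (v '' E) := by
      refine LipschitzOnWith.of_dist_le_mul ?_
      rintro _ ⟨x, hx, rfl⟩ _ ⟨y, hy, rfl⟩
      have := hdist _ (hinv x hx).1 _ (hinv y hy).1
      rw [(hinv x hx).2, (hinv y hy).2] at this
      simpa [Real.dist_eq] using this
    obtain ⟨F, hF, hE⟩ := hL.extend_real
    refine ⟨F, hF, fun x hx => ?_⟩
    rw [← hE ⟨x, hx, rfl⟩]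
    have := hdist _ (hinv x hx).1 _ hx
    rw [(hinv x hx).2, sub_self, abs_zero] at this
    exact sub_eq_zero.1 (abs_nonpos_iff.1 this)
  refine ⟨F ∘ v, v, hFf, fun x _ y _ hxy => ?_, fun x => ⟨ENNReal.toReal_nonneg, ?_⟩⟩
  · have := hF.dist_le_mul (v y) (v x)
    rw [Real.dist_eq, Real.dist_eq, abs_of_nonneg (sub_nonneg.2 (hmono hxy))] at this
    simpa using this
  · exact ENNReal.toReal_le_of_le_ofReal hV ((eVariationOn.mono f inter_subset_left).trans hf)

theorem DominatedOn.aemeasurable {h w : ℝ → ℝ} {s : Set ℝ} (hs : MeasurableSet s)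
    (H : DominatedOn h w s) : AEMeasurable h (volume.restrict s) := by
  have h1 : MonotoneOn (fun x => h x + w x) s := fun x hx y hy hxy => by
    have := (abs_le.1 (H x hx y hy hxy)).1
    simp only
    linarith
  have := (aemeasurable_restrict_of_monotoneOn (μ := volume) hs h1).sub
    (aemeasurable_restrict_of_monotoneOn (μ := volume) hs H.monotoneOn)
  simpa [Pi.sub_def] using this

theorem DominatedOn.integrableOn_Icc {h w : ℝ → ℝ} {a b : ℝ} (hab : a ≤ b)
    (H : DominatedOn h w (Icc a b)) : IntegrableOn h (Icc a b) := by
  refine Integrable.of_bound (H.aemeasurable measurableSet_Icc).aestronglyMeasurable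
    (|h a| + (w b - w a)) ?_
  filter_upwards [ae_restrict_mem measurableSet_Icc] with x hx
  have h1 := H a (left_mem_Icc.2 hab) x hx hx.1
  have h2 := H.monotoneOn hx (right_mem_Icc.2 hab) hx.2
  have h3 := abs_sub_abs_le_abs_sub (h x) (h a)
  rw [Real.norm_eq_abs]
  linarith

/-- An error term of the order of the mesh disappears when increments are added up along finer and
finer subdivisions. -/
theorem dominatedOn_of_mesh_error {k A C : ℝ → ℝ} {s : Set ℝ} (hs : Convex ℝ s)
    (H : ∀ x ∈ s, ∀ y ∈ s, x ≤ y → |k y - k x| ≤ A y - A x + (y - x) * (C y - C x)) :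
    DominatedOn k A s := by
  have key : ∀ n : ℕ, ∀ x ∈ s, ∀ y ∈ s, x ≤ y →
      |k y - k x| ≤ A y - A x + (1 / 2) ^ n * ((y - x) * (C y - C x)) := by
    intro n
    induction n with
    | zero => simpa using H
    | succ n ih =>
      -- bisect the interval
      intro x hx y hy hxy
      have hm : (x + y) / 2 ∈ s := by
        have := hs hx hy (a := 1 / 2) (b := 1 / 2) (by norm_num) (by norm_num) (by norm_num)
        convert this using 1
        simp only [smul_eq_mul]
        ring
      have h1 := ih x hx _ hm (by linarith)
      have h2 := ih _ hm y hy (by linarith)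
      have h3 := abs_sub_le (k y) (k ((x + y) / 2)) (k x)
      calc |k y - k x| ≤ _ := h3.trans (add_le_add h2 h1)
        _ = _ := by ring
  intro x hx y hy hxy
  have hlim : Tendsto (fun n : ℕ => A y - A x + (1 / 2 : ℝ) ^ n * ((y - x) * (C y - C x))) atTop
      (𝓝 (A y - A x + 0 * ((y - x) * (C y - C x)))) :=
    tendsto_const_nhds.add ((tendsto_pow_atTop_nhds_zero_of_lt_one (by norm_num)
      (by norm_num)).mul_const _)
  rw [zero_mul, add_zero] at hlim
  exact ge_of_tendsto' hlim fun n => key n x hx y hy hxy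

/-- Transport of a dominated function `k` by an increasing map `τ`, extended by zero outside the
image: the values `L ≤ R` of the dominating function outside the image pay for the jumps at the two
ends of the image. -/
theorem exists_dominatedOn_indicator_image {τ k G : ℝ → ℝ} {s : Set ℝ} {L R : ℝ}
    (hs : s.OrdConnected) (hτ : StrictMonoOn τ s) (hτc : ContinuousOn τ s) (hk : DominatedOn k G s)
    (hLR : L ≤ R) (hL : ∀ x ∈ s, |k x| ≤ G x - L) (hR : ∀ x ∈ s, |k x| ≤ R - G x) :
    ∃ W : ℝ → ℝ, DominatedOn ((τ '' s).indicator (k ∘ Function.invFunOn τ s)) W univ ∧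
      ∀ y, L ≤ W y ∧ W y ≤ R := by
  classical
  set S := Function.invFunOn τ s with hS
  have hmem : ∀ y ∈ τ '' s, S y ∈ s := fun y hy => Function.invFunOn_mem hy
  have hSτ : ∀ y ∈ τ '' s, τ (S y) = y := fun y hy => Function.invFunOn_eq hy
  have hJ : (τ '' s).OrdConnected :=
    (hs.isPreconnected.image τ hτc).ordConnected
  refine ⟨fun y => if y ∈ τ '' s then G (S y) else if ∃ z ∈ τ '' s, y < z then L else R,
    ?_, ?_⟩
  · intro x _ y _ hxy
    beta_reduce
    by_cases hx : x ∈ τ '' s <;> by_cases hy : y ∈ τ '' s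
    · have hSxy : S x ≤ S y := by
        rw [← hτ.le_iff_le (hmem x hx) (hmem y hy), hSτ x hx, hSτ y hy]
        exact hxy
      simpa [hx, hy] using hk _ (hmem x hx) _ (hmem y hy) hSxy
    · have hno : ¬ ∃ z ∈ τ '' s, y < z := fun ⟨z, hz, hyz⟩ => hy (hJ.out hx hz ⟨hxy, hyz.le⟩)
      rw [indicator_of_mem hx, indicator_of_notMem hy, if_pos hx, if_neg hy, if_neg hno,
        zero_sub, abs_neg]
      exact hR _ (hmem x hx)
    · have hlt : ∃ z ∈ τ '' s, x < z := ⟨y, hy, hxy.lt_of_ne fun h => hx (h ▸ hy)⟩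
      rw [indicator_of_notMem hx, indicator_of_mem hy, if_neg hx, if_pos hy, if_pos hlt, sub_zero]
      exact hL _ (hmem y hy)
    · rw [indicator_of_notMem hx, indicator_of_notMem hy, if_neg hx, if_neg hy, sub_self, abs_zero]
      by_cases h : ∃ z ∈ τ '' s, y < z
      · obtain ⟨z, hz, hyz⟩ := h
        rw [if_pos ⟨z, hz, hyz⟩, if_pos ⟨z, hz, hxy.trans_lt hyz⟩, sub_self]
      · rw [if_neg h]
        split_ifs <;> linarith
  · intro y
    simp only
    split_ifs with h1 h2
    · have h3 := hL _ (hmem y h1)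
      have h4 := hR _ (hmem y h1)
      have h5 := abs_nonneg (k (S y))
      exact ⟨by linarith, by linarith⟩
    · exact ⟨le_rfl, hLR⟩
    · exact ⟨hLR, le_rfl⟩

/-! ### The transfer operator of one branch -/

/-- `τ` is an expanding branch on `(a, b)`: its derivative is at least `l`, and the reciprocal of
its derivative is `D`-Lipschitz. For `l > 0` the first condition entails differentiability, since
`deriv` vanishes at points where `τ` is not differentiable. -/
structure IsExpandingBranch (τ : ℝ → ℝ) (l D a b : ℝ) : Prop where
  lt : a < b
  le_deriv : ∀ x ∈ Ioo a b, l ≤ deriv τ x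
  lipschitz : ∀ x ∈ Ioo a b, ∀ y ∈ Ioo a b, x ≤ y →
    |1 / deriv τ y - 1 / deriv τ x| ≤ D * (y - x)

/-- The contribution of the branch of `τ` on `(a, b)` to the transfer operator: the density of the
image under `τ` of the measure with density `h` on `(a, b)`. -/
noncomputable def branchTransfer (τ : ℝ → ℝ) (a b : ℝ) (h : ℝ → ℝ) : ℝ → ℝ :=
  (τ '' Ioo a b).indicator ((fun x => h x / deriv τ x) ∘ Function.invFunOn τ (Ioo a b))

namespace IsExpandingBranch

variable {τ : ℝ → ℝ} {l D a b : ℝ}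

theorem differentiableAt (hl : 0 < l) (H : IsExpandingBranch τ l D a b) {x : ℝ}
    (hx : x ∈ Ioo a b) : DifferentiableAt ℝ τ x :=
  differentiableAt_of_deriv_ne_zero (hl.trans_le (H.le_deriv x hx)).ne'

theorem continuousOn (hl : 0 < l) (H : IsExpandingBranch τ l D a b) :
    ContinuousOn τ (Ioo a b) := fun _ hx =>
  (H.differentiableAt hl hx).continuousAt.continuousWithinAt

theorem strictMonoOn (hl : 0 < l) (H : IsExpandingBranch τ l D a b) :
    StrictMonoOn τ (Ioo a b) := by
  refine strictMonoOn_of_deriv_pos (convex_Ioo a b) (H.continuousOn hl) fun x hx => ?_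
  rw [interior_Ioo] at hx
  exact hl.trans_le (H.le_deriv x hx)

theorem measurableSet_image (hl : 0 < l) (H : IsExpandingBranch τ l D a b) :
    MeasurableSet (τ '' Ioo a b) :=
  (isPreconnected_Ioo.image τ (H.continuousOn hl)).ordConnected.measurableSet

theorem nonneg (H : IsExpandingBranch τ l D a b) : 0 ≤ D := by
  obtain ⟨x, hx⟩ := exists_between H.lt
  obtain ⟨y, hy⟩ := exists_between hx.2
  have := (abs_nonneg _).trans (H.lipschitz x hx y ⟨hx.1.trans hy.1, hy.2⟩ hy.1.le)
  exact nonneg_of_mul_nonneg_left this (sub_pos.2 hy.1)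

/-- Dividing a function by the slope contracts variation by the factor `1 / l`, up to an error given
by the distortion `D` of the branch and the `L¹` norm. -/
theorem dominatedOn_div_deriv (hl : 0 < l) (H : IsExpandingBranch τ l D a b) {h w : ℝ → ℝ}
    (hw : DominatedOn h w (Icc a b)) :
    DominatedOn (fun x => h x / deriv τ x) (fun x => w x / l + D * ∫ t in a..x, |h t|)
      (Ioo a b) := by
  have hint : ∀ x ∈ Icc a b, ∀ y ∈ Icc a b, x ≤ y →
      IntervalIntegrable (fun t => |h t|) volume x y := fun x hx y hy hxy => by
    rw [intervalIntegrable_iff_integrableOn_Icc_of_le hxy]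
    exact ((hw.integrableOn_Icc H.lt.le).mono_set (Icc_subset_Icc hx.1 hy.2)).abs
  refine dominatedOn_of_mesh_error (C := fun x => D * w x) (convex_Ioo a b)
    fun x hx y hy hxy => ?_
  have hx' := Ioo_subset_Icc_self hx
  have hy' := Ioo_subset_Icc_self hy
  have ha := left_mem_Icc.2 H.lt.le
  -- compare the integral over `[x, y]` with its Riemann sum
  have hR : |h x| * (y - x) ≤ (∫ t in x..y, |h t|) + (w y - w x) * (y - x) := by
    have h1 : ∫ t in x..y, |h x| ≤ ∫ t in x..y, (|h t| + (w y - w x)) := by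
      refine intervalIntegral.integral_mono_on hxy intervalIntegrable_const
        ((hint x hx' y hy' hxy).add intervalIntegrable_const) fun t ht => ?_
      have ht' : t ∈ Icc a b := ⟨hx'.1.trans ht.1, ht.2.trans hy'.2⟩
      have h2 := hw x hx' t ht' ht.1
      have h3 := hw.monotoneOn ht' hy' ht.2
      have h4 := abs_sub_abs_le_abs_sub (h x) (h t)
      rw [abs_sub_comm] at h4
      linarith
    rw [intervalIntegral.integral_add (hint x hx' y hy' hxy) intervalIntegrable_const,
      intervalIntegral.integral_const, intervalIntegral.integral_const, smul_eq_mul,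
      smul_eq_mul] at h1
    linarith
  have hadd := intervalIntegral.integral_add_adjacent_intervals
    (hint a ha x hx' hx'.1) (hint x hx' y hy' hxy)
  have hsplit : h y / deriv τ y - h x / deriv τ x =
      (h y - h x) * (1 / deriv τ y) + h x * (1 / deriv τ y - 1 / deriv τ x) := by ring
  have h1 : |(h y - h x) * (1 / deriv τ y)| ≤ (w y - w x) * (1 / l) := by
    have hpos := hl.trans_le (H.le_deriv y hy)
    rw [abs_mul, abs_of_pos (one_div_pos.2 hpos)]
    exact mul_le_mul (hw x hx' y hy' hxy) (one_div_le_one_div_of_le hl (H.le_deriv y hy))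
      (one_div_pos.2 hpos).le ((abs_nonneg _).trans (hw x hx' y hy' hxy))
  have h2 : |h x * (1 / deriv τ y - 1 / deriv τ x)| ≤ D * (|h x| * (y - x)) := by
    rw [abs_mul]
    calc _ ≤ |h x| * (D * (y - x)) :=
          mul_le_mul_of_nonneg_left (H.lipschitz x hx y hy hxy) (abs_nonneg _)
      _ = _ := by ring
  have h3 := mul_le_mul_of_nonneg_left hR H.nonneg
  rw [hsplit, ← hadd]
  calc _ ≤ _ := (abs_add_le _ _).trans (add_le_add h1 (h2.trans h3))
    _ = _ := by ring

/-- The Lasota–Yorke estimate for one branch. The jumps at the ends of the image of the branch are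
controlled by comparing `h` with its value at a point where `|h|` is at most its mean. -/
theorem exists_dominatedOn_branchTransfer (hl : 0 < l) (H : IsExpandingBranch τ l D a b)
    {h w : ℝ → ℝ} (hw : DominatedOn h w (Icc a b)) :
    ∃ (W : ℝ → ℝ) (L R : ℝ), DominatedOn (branchTransfer τ a b h) W univ ∧
      (∀ y, L ≤ W y ∧ W y ≤ R) ∧
      R - L = 2 / l * (w b - w a) + (D + 2 / (l * (b - a))) * ∫ t in a..b, |h t| := by
  have hint := (hw.integrableOn_Icc H.lt.le).abs
  have ha := left_mem_Icc.2 H.lt.le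
  have hb := right_mem_Icc.2 H.lt.le
  have hba := sub_pos.2 H.lt
  set c : ℝ := (∫ t in a..b, |h t|) / (b - a) with hc
  obtain ⟨z, hz, hzc⟩ : ∃ z ∈ Ioo a b, |h z| ≤ c := by
    obtain ⟨z, hz, hzc⟩ := exists_le_setAverage (μ := volume) (s := Ioo a b) (f := fun t => |h t|)
      (by simpa using H.lt) (by simp) (IntegrableOn.mono_set hint Ioo_subset_Icc_self)
    refine ⟨z, hz, hzc.trans_eq ?_⟩
    rw [setAverage_eq, hc, intervalIntegral.integral_of_le H.lt.le, integral_Ioc_eq_integral_Ioo]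
    simp [measureReal_def, hba.le, div_eq_inv_mul]
  have hz' := Ioo_subset_Icc_self hz
  set G : ℝ → ℝ := fun x => w x / l + D * ∫ t in a..x, |h t| with hG
  have hwaz := hw.monotoneOn ha hz' hz'.1
  have hwzb := hw.monotoneOn hz' hb hz'.2
  have hc0 : 0 ≤ c := (abs_nonneg _).trans hzc
  -- bounds of `|h / τ'|` in terms of the dominating function
  have hval : ∀ x ∈ Ioo a b, |h x / deriv τ x| ≤ (c + |w x - w z|) / l := by
    intro x hx
    have hx' := Ioo_subset_Icc_self hx
    have h1 : |h x| ≤ c + |w x - w z| := by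
      have h2 := abs_sub_abs_le_abs_sub (h x) (h z)
      rcases le_total z x with hzx | hzx
      · have h3 := (hw z hz' x hx' hzx).trans (le_abs_self _)
        linarith
      · have h3 := (hw x hx' z hz' hzx).trans (le_abs_self _)
        rw [abs_sub_comm, abs_sub_comm (w z)] at h3
        linarith
    rw [abs_div, abs_of_pos (hl.trans_le (H.le_deriv x hx))]
    exact div_le_div₀ ((abs_nonneg _).trans h1) h1 hl (H.le_deriv x hx)
  have hIx : ∀ x ∈ Ioo a b, 0 ≤ D * ∫ t in a..x, |h t| := fun x hx =>
    mul_nonneg H.nonneg (intervalIntegral.integral_nonneg hx.1.le fun _ _ => abs_nonneg _)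
  have hIx' : ∀ x ∈ Ioo a b, D * (∫ t in a..x, |h t|) ≤ D * ∫ t in a..b, |h t| := fun x hx =>
    mul_le_mul_of_nonneg_left (intervalIntegral.integral_mono_interval le_rfl hx.1.le hx.2.le
      (Eventually.of_forall fun _ => abs_nonneg _)
      ((intervalIntegrable_iff_integrableOn_Icc_of_le H.lt.le).2 hint)) H.nonneg
  have hL : ∀ x ∈ Ioo a b,
      |h x / deriv τ x| ≤ G x - (w a / l - (c + (w z - w a)) / l) := by
    intro x hx
    have hax := hw.monotoneOn ha (Ioo_subset_Icc_self hx) hx.1.le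
    have h1 : (c + |w x - w z|) / l ≤ w x / l - (w a / l - (c + (w z - w a)) / l) := by
      rw [← sub_div, ← sub_div]
      refine div_le_div_of_nonneg_right ?_ hl.le
      rcases abs_cases (w x - w z) with h | h <;> linarith
    have h2 := hval x hx
    have h3 := hIx x hx
    simp only [hG]
    linarith
  have hR : ∀ x ∈ Ioo a b,
      |h x / deriv τ x| ≤ (G b + (c + (w b - w z)) / l) - G x := by
    intro x hx
    have hxb := hw.monotoneOn (Ioo_subset_Icc_self hx) hb hx.2.le
    have h1 : (c + |w x - w z|) / l ≤ (w b / l + (c + (w b - w z)) / l) - w x / l := by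
      rw [← add_div, ← sub_div]
      refine div_le_div_of_nonneg_right ?_ hl.le
      rcases abs_cases (w x - w z) with h | h <;> linarith
    have h2 := hval x hx
    have h3 := hIx' x hx
    simp only [hG]
    linarith
  obtain ⟨W, hW, hWb⟩ := exists_dominatedOn_indicator_image ordConnected_Ioo (H.strictMonoOn hl)
    (H.continuousOn hl) (H.dominatedOn_div_deriv hl hw)
    (by
      have h1 := hL z hz
      have h2 := hR z hz
      have h3 := abs_nonneg (h z / deriv τ z)
      linarith) hL hR
  refine ⟨W, _, _, hW, hWb, ?_⟩
  simp only [hG, hc]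
  field_simp
  ring

theorem integral_branchTransfer_mul (hl : 0 < l) (H : IsExpandingBranch τ l D a b) {s : Set ℝ}
    (hs : MapsTo τ (Ioo a b) s) (h ψ : ℝ → ℝ) :
    ∫ y in s, branchTransfer τ a b h y * ψ y = ∫ x in a..b, h x * ψ (τ x) := by
  have hinj := (H.strictMonoOn hl).injOn
  have h1 : (fun y => branchTransfer τ a b h y * ψ y) = (τ '' Ioo a b).indicator
      (fun y => ((fun x => h x / deriv τ x) ∘ Function.invFunOn τ (Ioo a b)) y * ψ y) := by
    ext y
    by_cases hy : y ∈ τ '' Ioo a b <;> simp [branchTransfer, hy]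
  rw [h1, setIntegral_indicator (H.measurableSet_image hl), inter_eq_right.2 hs.image_subset,
    integral_image_eq_integral_abs_deriv_smul measurableSet_Ioo
      (fun x hx => (H.differentiableAt hl hx).hasDerivAt.hasDerivWithinAt) hinj,
    intervalIntegral.integral_of_le H.lt.le, integral_Ioc_eq_integral_Ioo]
  refine setIntegral_congr_fun measurableSet_Ioo fun x hx => ?_
  have hpos := hl.trans_le (H.le_deriv x hx)
  have hinv : Function.invFunOn τ (Ioo a b) (τ x) = x := hinj.leftInvOn_invFunOn hx
  simp only [Function.comp, hinv, smul_eq_mul, abs_of_pos hpos]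
  field_simp

end IsExpandingBranch

/-! ### The transfer operator of a piecewise expanding map -/

theorem sum_fin_sub {n : ℕ} (F : Fin (n + 1) → ℝ) :
    ∑ i : Fin n, (F i.succ - F i.castSucc) = F (Fin.last n) - F 0 := by
  induction n with
  | zero => simp
  | succ n ih =>
    rw [Fin.sum_univ_castSucc]
    have := ih fun i => F i.castSucc
    simp only [Fin.succ_castSucc] at this ⊢
    rw [this, Fin.succ_last, Fin.castSucc_zero]
    ring

/-- `τ` is a measurable map of `[0,1]` into itself with expanding branches between the successive
points of `d`. -/
structure HasExpandingBranches {n : ℕ} (τ : ℝ → ℝ) (d : Fin (n + 1) → ℝ) (l D : ℝ) : Prop where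
  measurable : Measurable τ
  mapsTo : MapsTo τ (Icc 0 1) (Icc 0 1)
  strictMono : StrictMono d
  first : d 0 = 0
  last : d (Fin.last n) = 1
  branch : ∀ i : Fin n, IsExpandingBranch τ l D (d i.castSucc) (d i.succ)

/-- The transfer operator of `τ`: it sends the density of a measure to the density of its image. -/
noncomputable def transfer {n : ℕ} (τ : ℝ → ℝ) (d : Fin (n + 1) → ℝ) (h : ℝ → ℝ) : ℝ → ℝ :=
  fun y => ∑ i : Fin n, branchTransfer τ (d i.castSucc) (d i.succ) h y

namespace HasExpandingBranches

variable {n : ℕ} {τ : ℝ → ℝ} {d : Fin (n + 1) → ℝ} {l D : ℝ}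

theorem mem_Icc (H : HasExpandingBranches τ d l D) (j : Fin (n + 1)) : d j ∈ Icc (0 : ℝ) 1 :=
  ⟨H.first ▸ H.strictMono.monotone (Fin.zero_le j),
    H.last ▸ H.strictMono.monotone (Fin.le_last j)⟩

theorem Icc_subset (H : HasExpandingBranches τ d l D) (i : Fin n) :
    Icc (d i.castSucc) (d i.succ) ⊆ Icc 0 1 :=
  Icc_subset_Icc (H.mem_Icc _).1 (H.mem_Icc _).2

theorem sum_integral (H : HasExpandingBranches τ d l D) {g : ℝ → ℝ}
    (hg : IntegrableOn g (Icc 0 1)) :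
    ∑ i : Fin n, ∫ x in d i.castSucc..d i.succ, g x = ∫ x in (0 : ℝ)..1, g x := by
  have hint : ∀ j, IntervalIntegrable g volume 0 (d j) := fun j => by
    rw [intervalIntegrable_iff_integrableOn_Icc_of_le (H.mem_Icc j).1]
    exact hg.mono_set (Icc_subset_Icc le_rfl (H.mem_Icc j).2)
  have := sum_fin_sub fun j => ∫ x in (0 : ℝ)..d j, g x
  rw [H.first, H.last, intervalIntegral.integral_same, sub_zero] at this
  rw [← this]
  exact Finset.sum_congr rfl fun i _ =>
    (intervalIntegral.integral_interval_sub_left (hint _) (hint _)).symm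

/-- The Lasota–Yorke inequality: `Var (L h) ≤ (2 / l) Var h + (D + 2 / (l δ)) ‖h‖₁`. -/
theorem exists_dominatedOn_transfer (hl : 0 < l) (H : HasExpandingBranches τ d l D) {δ : ℝ}
    (hδ : 0 < δ) (hδd : ∀ i : Fin n, δ ≤ d i.succ - d i.castSucc) {h w : ℝ → ℝ}
    (hw : DominatedOn h w (Icc 0 1)) :
    ∃ W : ℝ → ℝ, DominatedOn (transfer τ d h) W (Icc 0 1) ∧
      W 1 - W 0 ≤ 2 / l * (w 1 - w 0) + (D + 2 / (l * δ)) * ∫ t in (0 : ℝ)..1, |h t| := by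
  have hwi : ∀ i : Fin n, DominatedOn h w (Icc (d i.castSucc) (d i.succ)) := fun i x hx y hy =>
    hw x (H.Icc_subset i hx) y (H.Icc_subset i hy)
  choose W L R hW hLR hRL using fun i => (H.branch i).exists_dominatedOn_branchTransfer hl (hwi i)
  refine ⟨fun x => ∑ i, W i x, DominatedOn.sum fun i x _ y _ =>
    hW i x (mem_univ x) y (mem_univ y), ?_⟩
  have hsumw := sum_fin_sub fun j => w (d j)
  rw [H.first, H.last] at hsumw
  rw [← hsumw, ← H.sum_integral (hw.integrableOn_Icc zero_le_one).abs, Finset.mul_sum,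
    Finset.mul_sum, ← Finset.sum_add_distrib, ← Finset.sum_sub_distrib]
  refine Finset.sum_le_sum fun i _ => ?_
  have h1 := (hLR i 1).2
  have h2 := (hLR i 0).1
  have h3 : (D + 2 / (l * (d i.succ - d i.castSucc))) * (∫ t in d i.castSucc..d i.succ, |h t|) ≤
      (D + 2 / (l * δ)) * ∫ t in d i.castSucc..d i.succ, |h t| := by
    refine mul_le_mul_of_nonneg_right ?_
      (intervalIntegral.integral_nonneg (H.branch i).lt.le fun _ _ => abs_nonneg _)
    gcongr
    exact hδd i
  linarith [hRL i]

/-- Duality between the transfer operator and composition with `τ`. -/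
theorem integral_transfer_mul (hl : 0 < l) (H : HasExpandingBranches τ d l D) {h w ψ : ℝ → ℝ}
    (hw : DominatedOn h w (Icc 0 1)) (hψ : Measurable ψ) (hψ1 : ∀ x, |ψ x| ≤ 1) :
    ∫ y in (0 : ℝ)..1, transfer τ d h y * ψ y = ∫ x in (0 : ℝ)..1, h x * ψ (τ x) := by
  have hmul : ∀ (g φ : ℝ → ℝ), IntegrableOn g (Icc 0 1) → Measurable φ → (∀ x, |φ x| ≤ 1) →
      IntegrableOn (fun x => g x * φ x) (Icc 0 1) := fun g φ hg hφ hφ1 =>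
    hg.mul_bdd (c := 1) hφ.aestronglyMeasurable (Eventually.of_forall hφ1)
  have hψτ : Measurable fun x => ψ (τ x) := hψ.comp H.measurable
  rw [← H.sum_integral (hmul _ _ (hw.integrableOn_Icc zero_le_one) hψτ fun x => hψ1 _),
    intervalIntegral.integral_of_le zero_le_one, ← integral_Icc_eq_integral_Ioc]
  simp only [transfer, Finset.sum_mul]
  rw [integral_finsetSum]
  · refine Finset.sum_congr rfl fun i _ => ?_
    exact (H.branch i).integral_branchTransfer_mul hl
      (H.mapsTo.mono_left (Ioo_subset_Icc_self.trans (H.Icc_subset i))) h ψ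
  · intro i _
    obtain ⟨W, L, R, hW, -⟩ := (H.branch i).exists_dominatedOn_branchTransfer hl (h := h) (w := w)
      fun x hx y hy => hw x (H.Icc_subset i hx) y (H.Icc_subset i hy)
    refine hmul _ _ (DominatedOn.integrableOn_Icc zero_le_one (w := W) ?_) hψ hψ1
    exact fun x _ y _ => hW x (mem_univ x) y (mem_univ y)

/-- The transfer operator does not increase the `L¹` distance to an invariant density. -/
theorem integral_abs_transfer_sub_le (hl : 0 < l) (H : HasExpandingBranches τ d l D)
    {h w W f : ℝ → ℝ} (hw : DominatedOn h w (Icc 0 1))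
    (hW : DominatedOn (transfer τ d h) W (Icc 0 1)) (hf : IntegrableOn f (Icc 0 1))
    (hinv : ∀ ψ : ℝ → ℝ, Measurable ψ → (∀ x, |ψ x| ≤ 1) →
      ∫ x in (0 : ℝ)..1, f x * ψ (τ x) = ∫ x in (0 : ℝ)..1, f x * ψ x) :
    ∫ x in (0 : ℝ)..1, |transfer τ d h x - f x| ≤ ∫ x in (0 : ℝ)..1, |h x - f x| := by
  have hh := hw.integrableOn_Icc zero_le_one
  have hLh := hW.integrableOn_Icc zero_le_one
  have hu : IntegrableOn (fun x => transfer τ d h x - f x) (Icc 0 1) := hLh.sub hf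
  -- `ψ` is a measurable version of the sign of `L h - f`
  set u' := hu.1.mk _ with hu'
  have hu'm : Measurable u' := hu.1.stronglyMeasurable_mk.measurable
  set ψ : ℝ → ℝ := fun x => if 0 ≤ u' x then 1 else -1 with hψdef
  have hψ : Measurable ψ := Measurable.ite (measurableSet_le measurable_const hu'm)
    measurable_const measurable_const
  have hψ1 : ∀ x, |ψ x| ≤ 1 := fun x => by
    simp only [hψdef]
    split_ifs <;> simp
  have hmul : ∀ (g φ : ℝ → ℝ), IntegrableOn g (Icc 0 1) → Measurable φ → (∀ x, |φ x| ≤ 1) →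
      IntervalIntegrable (fun x => g x * φ x) volume 0 1 := fun g φ hg hφ hφ1 => by
    rw [intervalIntegrable_iff_integrableOn_Icc_of_le zero_le_one]
    exact hg.mul_bdd (c := 1) hφ.aestronglyMeasurable (Eventually.of_forall hφ1)
  have hψτ : Measurable fun x => ψ (τ x) := hψ.comp H.measurable
  calc ∫ x in (0 : ℝ)..1, |transfer τ d h x - f x|
      = ∫ x in (0 : ℝ)..1, (transfer τ d h x * ψ x - f x * ψ x) := by
        rw [intervalIntegral.integral_of_le zero_le_one,
          intervalIntegral.integral_of_le zero_le_one, ← integral_Icc_eq_integral_Ioc,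
          ← integral_Icc_eq_integral_Ioc]
        refine integral_congr_ae ?_
        filter_upwards [hu.1.ae_eq_mk] with x hx
        rw [← sub_mul, hx]
        change |u' x| = u' x * ψ x
        simp only [hψdef]
        split_ifs with h0
        · rw [abs_of_nonneg h0, mul_one]
        · rw [abs_of_neg (not_le.1 h0), mul_neg_one]
    _ = ∫ x in (0 : ℝ)..1, (h x * ψ (τ x) - f x * ψ (τ x)) := by
        rw [intervalIntegral.integral_sub (hmul _ _ hLh hψ hψ1) (hmul _ _ hf hψ hψ1),
          intervalIntegral.integral_sub (hmul _ _ hh hψτ fun x => hψ1 _)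
            (hmul _ _ hf hψτ fun x => hψ1 _),
          H.integral_transfer_mul hl hw hψ hψ1, hinv ψ hψ hψ1]
    _ ≤ ∫ x in (0 : ℝ)..1, |h x - f x| := by
        refine intervalIntegral.integral_mono_on zero_le_one
          ((hmul _ _ hh hψτ fun x => hψ1 _).sub (hmul _ _ hf hψτ fun x => hψ1 _))
          ((intervalIntegrable_iff_integrableOn_Icc_of_le zero_le_one).2 (hh.sub hf).abs)
          fun x _ => ?_
        rw [← sub_mul]
        refine (le_abs_self _).trans ?_
        rw [abs_mul]
        exact mul_le_of_le_one_right (abs_nonneg _) (hψ1 _)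

/-- Iterating the Lasota–Yorke inequality: a function of bounded variation within `ε` of an
invariant density `f` can be replaced by one whose variation has forgotten the initial one. -/
theorem exists_dominatedOn_iterate (hl : 2 < l) (H : HasExpandingBranches τ d l D) {δ : ℝ}
    (hδ : 0 < δ) (hδd : ∀ i : Fin n, δ ≤ d i.succ - d i.castSucc) {f : ℝ → ℝ}
    (hf : IntegrableOn f (Icc 0 1))
    (hinv : ∀ ψ : ℝ → ℝ, Measurable ψ → (∀ x, |ψ x| ≤ 1) →
      ∫ x in (0 : ℝ)..1, f x * ψ (τ x) = ∫ x in (0 : ℝ)..1, f x * ψ x)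
    {ε : ℝ} {h w : ℝ → ℝ} (hw : DominatedOn h w (Icc 0 1))
    (hε : ∫ x in (0 : ℝ)..1, |h x - f x| ≤ ε) (hD : 0 ≤ D) (k : ℕ) :
    ∃ h' w' : ℝ → ℝ, DominatedOn h' w' (Icc 0 1) ∧ ∫ x in (0 : ℝ)..1, |h' x - f x| ≤ ε ∧
      w' 1 - w' 0 ≤ (2 / l) ^ k * (w 1 - w 0) +
        (D + 2 / (l * δ)) * ((∫ x in (0 : ℝ)..1, |f x|) + ε) / (1 - 2 / l) := by
  have hl0 : 0 < l := two_pos.trans hl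
  have ha : 0 < 1 - 2 / l := sub_pos.2 ((div_lt_one hl0).2 hl)
  have hε0 : 0 ≤ ε :=
    (intervalIntegral.integral_nonneg zero_le_one fun _ _ => abs_nonneg _).trans hε
  have hf0 : 0 ≤ ∫ x in (0 : ℝ)..1, |f x| :=
    intervalIntegral.integral_nonneg zero_le_one fun _ _ => abs_nonneg _
  have hC : 0 ≤ (D + 2 / (l * δ)) * ((∫ x in (0 : ℝ)..1, |f x|) + ε) := by positivity
  set C := (D + 2 / (l * δ)) * ((∫ x in (0 : ℝ)..1, |f x|) + ε) with hCdef
  induction k with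
  | zero =>
    refine ⟨h, w, hw, hε, ?_⟩
    have := div_nonneg hC ha.le
    rw [pow_zero, one_mul]
    linarith
  | succ k ih =>
    obtain ⟨h', w', hw', hε', hV⟩ := ih
    obtain ⟨W, hW, hWV⟩ := H.exists_dominatedOn_transfer hl0 hδ hδd hw'
    refine ⟨_, W, hW, (H.integral_abs_transfer_sub_le hl0 hw' hW hf hinv).trans hε', ?_⟩
    have hnorm : ∫ t in (0 : ℝ)..1, |h' t| ≤ (∫ x in (0 : ℝ)..1, |f x|) + ε := by
      have hint : ∀ g : ℝ → ℝ, IntegrableOn g (Icc 0 1) →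
          IntervalIntegrable (fun x => |g x|) volume 0 1 := fun g hg =>
        (intervalIntegrable_iff_integrableOn_Icc_of_le zero_le_one).2 hg.abs
      have hh' := hw'.integrableOn_Icc zero_le_one
      have hhf := hint (fun x => h' x - f x) (hh'.sub hf)
      calc ∫ t in (0 : ℝ)..1, |h' t| ≤ ∫ t in (0 : ℝ)..1, (|f t| + |h' t - f t|) :=
            intervalIntegral.integral_mono_on zero_le_one (hint _ hh')
              ((hint _ hf).add hhf) fun x _ => by
                have := abs_sub_abs_le_abs_sub (h' x) (f x)
                linarith
        _ ≤ _ := by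
            rw [intervalIntegral.integral_add (hint _ hf) hhf]
            exact add_le_add_right hε' _
    have h1 : (D + 2 / (l * δ)) * (∫ t in (0 : ℝ)..1, |h' t|) ≤ C :=
      mul_le_mul_of_nonneg_left hnorm (by positivity)
    have h2 := mul_le_mul_of_nonneg_left hV (by positivity : 0 ≤ 2 / l)
    have h3 : 2 / l * ((2 / l) ^ k * (w 1 - w 0) + C / (1 - 2 / l)) + C =
        (2 / l) ^ (k + 1) * (w 1 - w 0) + C / (1 - 2 / l) := by
      have := ha.ne'
      have h4 : C = (1 - 2 / l) * (C / (1 - 2 / l)) := by rw [mul_div_cancel₀ _ this]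
      rw [pow_succ]
      linear_combination h4
    linarith

end HasExpandingBranches

/-- Functions of bounded variation are dense in `L¹[0,1]`, since polynomials are. -/
theorem exists_dominatedOn_integral_abs_sub_le {f : ℝ → ℝ} (hf : IntegrableOn f (Icc 0 1))
    {ε : ℝ} (hε : 0 < ε) :
    ∃ h w : ℝ → ℝ, DominatedOn h w (Icc 0 1) ∧ ∫ x in (0 : ℝ)..1, |h x - f x| ≤ ε := by
  obtain ⟨g, hg, hgi⟩ := Integrable.exists_boundedContinuous_integral_sub_le hf (half_pos hε)
  obtain ⟨p, hp⟩ := exists_polynomial_near_of_continuousOn 0 1 g g.continuous.continuousOn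
    (ε / 2) (half_pos hε)
  have hint : ∀ u : ℝ → ℝ, IntegrableOn u (Icc 0 1) →
      IntervalIntegrable (fun x => |u x|) volume 0 1 := fun u hu =>
    (intervalIntegrable_iff_integrableOn_Icc_of_le zero_le_one).2 hu.abs
  have hpi : IntegrableOn (fun x => p.eval x) (Icc 0 1) :=
    p.continuous.continuousOn.integrableOn_Icc
  have hfg := hint (fun x => f x - g x) (hf.sub hgi)
  obtain ⟨M, hM⟩ := isCompact_Icc.exists_bound_of_continuousOn (s := Icc (0 : ℝ) 1)
    (f := fun x => p.derivative.eval x) p.derivative.continuous.continuousOn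
  refine ⟨fun x => p.eval x, fun x => M * x, fun x hx y hy hxy => ?_, ?_⟩
  · have := (convex_Icc (0 : ℝ) 1).norm_image_sub_le_of_norm_deriv_le
      (f := fun x => p.eval x) (fun x _ => p.differentiableAt)
      (fun x hx => by simpa using hM x hx) hx hy
    rw [Real.norm_eq_abs, Real.norm_eq_abs, abs_of_nonneg (sub_nonneg.2 hxy)] at this
    linarith
  · calc ∫ x in (0 : ℝ)..1, |p.eval x - f x|
        ≤ ∫ x in (0 : ℝ)..1, (ε / 2 + |f x - g x|) :=
          intervalIntegral.integral_mono_on zero_le_one (hint _ (hpi.sub hf))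
            (intervalIntegrable_const.add hfg) fun x hx => by
              have h1 := abs_sub_le (p.eval x) (g x) (f x)
              rw [abs_sub_comm (g x)] at h1
              linarith [hp x hx]
      _ = ε / 2 + ∫ x in Icc (0 : ℝ) 1, |f x - g x| := by
          rw [intervalIntegral.integral_add intervalIntegrable_const hfg,
            integral_Icc_eq_integral_Ioc, ← intervalIntegral.integral_of_le zero_le_one]
          simp
      _ ≤ ε := by
          have : ∫ x in Icc (0 : ℝ) 1, |f x - g x| ≤ ε / 2 := hg
          linarith

/-- An invariant density is the `L¹` limit of functions whose variation is at most the bound given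
by the Lasota–Yorke inequality, up to an arbitrarily small error. -/
theorem HasExpandingBranches.exists_dominatedOn_near {n : ℕ} {τ : ℝ → ℝ} {d : Fin (n + 1) → ℝ}
    {l D : ℝ} (hl : 2 < l) (H : HasExpandingBranches τ d l D) {δ : ℝ}
    (hδ : 0 < δ) (hδd : ∀ i : Fin n, δ ≤ d i.succ - d i.castSucc) {f : ℝ → ℝ}
    (hf : IntegrableOn f (Icc 0 1)) (hf1 : ∫ x in (0 : ℝ)..1, |f x| = 1) (hD : 0 ≤ D)
    (hinv : ∀ ψ : ℝ → ℝ, Measurable ψ → (∀ x, |ψ x| ≤ 1) →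
      ∫ x in (0 : ℝ)..1, f x * ψ (τ x) = ∫ x in (0 : ℝ)..1, f x * ψ x)
    {ε : ℝ} (hε : 0 < ε) :
    ∃ h w : ℝ → ℝ, DominatedOn h w (Icc 0 1) ∧ ∫ x in (0 : ℝ)..1, |h x - f x| ≤ ε ∧
      w 1 - w 0 ≤ ε + (D + 2 / (l * δ)) * (1 + ε) / (1 - 2 / l) := by
  obtain ⟨h, w, hw, hh⟩ := exists_dominatedOn_integral_abs_sub_le hf hε
  have hl0 : 0 < l := two_pos.trans hl
  have hlim : Tendsto (fun k : ℕ => (2 / l) ^ k * (w 1 - w 0)) atTop (𝓝 (0 * (w 1 - w 0))) :=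
    (tendsto_pow_atTop_nhds_zero_of_lt_one (by positivity) ((div_lt_one hl0).2 hl)).mul_const _
  rw [zero_mul] at hlim
  obtain ⟨k, hk⟩ := (hlim.eventually_le_const hε).exists
  obtain ⟨h', w', hw', hh', hV⟩ := H.exists_dominatedOn_iterate hl hδ hδd hf hinv hw hh hD k
  rw [hf1] at hV
  exact ⟨h', w', hw', hh', by linarith⟩

/-! ### Branches of a piecewise expanding map -/

theorem contDiffOn_derivWithin_of_eqOn {g τ : ℝ → ℝ} {a b : ℝ} (hab : a < b) {m : ℕ}
    (hg : ContDiffOn ℝ (m + 1) g (Icc a b)) (h : EqOn g τ (Ioo a b)) :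
    ContDiffOn ℝ m (derivWithin g (Icc a b)) (Icc a b) ∧
      EqOn (derivWithin g (Icc a b)) (deriv τ) (Ioo a b) := by
  refine ⟨hg.derivWithin (uniqueDiffOn_Icc hab) le_rfl, fun x hx => ?_⟩
  rw [derivWithin_of_mem_nhds (Icc_mem_nhds hx.1 hx.2)]
  exact (h.eventuallyEq_of_mem (Ioo_mem_nhds hx.1 hx.2)).deriv_eq

/-- A function with a `C²` extension to a compact interval has bounded first and second
derivatives. -/
theorem exists_bound_of_contDiffOn {g τ : ℝ → ℝ} {a b : ℝ} (hab : a < b)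
    (hg : ContDiffOn ℝ 2 g (Icc a b)) (h : EqOn g τ (Ioo a b)) :
    ∃ M, ∀ x ∈ Ioo a b, DifferentiableAt ℝ (deriv τ) x ∧ |deriv τ x| ≤ M ∧
      |deriv (deriv τ) x| ≤ M := by
  obtain ⟨h1, e1⟩ := contDiffOn_derivWithin_of_eqOn (m := 1) hab
    (by simpa [one_add_one_eq_two] using hg) h
  obtain ⟨h2, e2⟩ := contDiffOn_derivWithin_of_eqOn (m := 0) hab (by simpa using h1) e1
  obtain ⟨M₁, hM₁⟩ := isCompact_Icc.exists_bound_of_continuousOn h1.continuousOn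
  obtain ⟨M₂, hM₂⟩ := isCompact_Icc.exists_bound_of_continuousOn h2.continuousOn
  refine ⟨max M₁ M₂, fun x hx => ⟨?_, ?_, ?_⟩⟩
  · have := (h1.differentiableOn (by simp)).differentiableAt (Icc_mem_nhds hx.1 hx.2)
    exact this.congr_of_eventuallyEq
      (e1.eventuallyEq_of_mem (Ioo_mem_nhds hx.1 hx.2)).symm
  · rw [← e1 hx]
    exact (hM₁ x (Ioo_subset_Icc_self hx)).trans (le_max_left _ _)
  · rw [← e2 hx]
    exact (hM₂ x (Ioo_subset_Icc_self hx)).trans (le_max_right _ _)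

/-- The supremum of `|T'' / (T')²|` over the regular points. -/
noncomputable def distortion {n : ℕ} (T : I → I) (d : Fin (n + 1) → ℝ) : ℝ :=
  sSup ((fun x => |deriv (deriv (realMap T)) x / (deriv (realMap T) x) ^ 2|) '' regularSet d)

theorem distortion_nonneg {n : ℕ} {T : I → I} {d : Fin (n + 1) → ℝ} : 0 ≤ distortion T d := by
  refine Real.sSup_nonneg ?_
  rintro _ ⟨y, -, rfl⟩
  exact abs_nonneg _

namespace IsPiecewiseExpanding

variable {n : ℕ} {T : I → I} {d : Fin (n + 1) → ℝ}

theorem neZero (hT : IsPiecewiseExpanding T d) : NeZero n := by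
  refine ⟨?_⟩
  rintro rfl
  exact zero_ne_one (hT.first.symm.trans hT.last)

theorem Ioo_subset_regularSet (hT : IsPiecewiseExpanding T d) (i : Fin n) :
    Ioo (d i.castSucc) (d i.succ) ⊆ regularSet d := by
  intro x hx
  refine ⟨⟨?_, ?_⟩, ?_⟩
  · rw [← hT.first]
    exact (hT.strictMono.monotone (Fin.zero_le i.castSucc)).trans hx.1.le
  · rw [← hT.last]
    exact hx.2.le.trans (hT.strictMono.monotone (Fin.le_last i.succ))
  · rintro ⟨j, rfl⟩
    have h1 := hT.strictMono.lt_iff_lt.1 hx.1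
    have h2 := hT.strictMono.lt_iff_lt.1 hx.2
    rw [Fin.lt_def] at h1 h2
    simp only [Fin.val_castSucc, Fin.val_succ] at h1 h2
    omega

theorem exists_mem_Ioo (hT : IsPiecewiseExpanding T d) {x : ℝ} (hx : x ∈ regularSet d) :
    ∃ i : Fin n, x ∈ Ioo (d i.castSucc) (d i.succ) := by
  have hne : ∀ j, d j ≠ x := fun j h => hx.2 ⟨j, h⟩
  by_contra! hno
  have hlt : ∀ j, d j < x := fun j => by
    induction j using Fin.induction with
    | zero => exact lt_of_le_of_ne (hT.first ▸ hx.1.1) (hne _)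
    | succ i ih =>
      exact lt_of_le_of_ne (not_lt.1 fun h => hno i ⟨ih, h⟩) (hne _)
  exact absurd (hT.last ▸ hlt (Fin.last n)) (not_lt.2 hx.1.2)

theorem minSlope_le_deriv (hT : IsPiecewiseExpanding T d) {x : ℝ} (hx : x ∈ regularSet d) :
    minSlope T d ≤ deriv (realMap T) x := by
  refine csInf_le ?_ ⟨x, hx, rfl⟩
  -- the infimum of a set that is not bounded below would be zero
  by_contra h
  have h1 := hT.expanding
  rw [minSlope, Real.sInf_of_not_bddBelow h] at h1
  exact absurd h1 (by norm_num)

theorem exists_bound (hT : IsPiecewiseExpanding T d) :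
    ∃ M, ∀ x ∈ regularSet d, DifferentiableAt ℝ (deriv (realMap T)) x ∧
      |deriv (realMap T) x| ≤ M ∧ |deriv (deriv (realMap T)) x| ≤ M := by
  have : ∀ i : Fin n, ∃ M, ∀ x ∈ Ioo (d i.castSucc) (d i.succ),
      DifferentiableAt ℝ (deriv (realMap T)) x ∧ |deriv (realMap T) x| ≤ M ∧
      |deriv (deriv (realMap T)) x| ≤ M := fun i => by
    obtain ⟨g, hg, hgT⟩ := hT.extends_C2 i
    exact exists_bound_of_contDiffOn (hT.strictMono i.castSucc_lt_succ) hg hgT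
  choose M hM using this
  obtain ⟨K, hK⟩ := (Finset.univ.image M).exists_le
  refine ⟨K, fun x hx => ?_⟩
  obtain ⟨i, hi⟩ := hT.exists_mem_Ioo hx
  have hi' := hM i x hi
  have hMK := hK (M i) (Finset.mem_image_of_mem _ (Finset.mem_univ i))
  exact ⟨hi'.1, hi'.2.1.trans hMK, hi'.2.2.trans hMK⟩

theorem abs_div_le_distortion (hT : IsPiecewiseExpanding T d) {x : ℝ} (hx : x ∈ regularSet d) :
    |deriv (deriv (realMap T)) x / (deriv (realMap T) x) ^ 2| ≤ distortion T d := by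
  obtain ⟨M, hM⟩ := hT.exists_bound
  refine le_csSup ⟨M, ?_⟩ ⟨x, hx, rfl⟩
  rintro _ ⟨y, hy, rfl⟩
  have h1 : 1 ≤ deriv (realMap T) y := hT.expanding.le.trans (hT.minSlope_le_deriv hy)
  simp only
  rw [abs_div, abs_of_pos (pow_pos (one_pos.trans_le h1) 2)]
  exact (div_le_self (abs_nonneg _) (one_le_pow₀ h1)).trans (hM y hy).2.2

theorem isExpandingBranch (hT : IsPiecewiseExpanding T d) (i : Fin n) :
    IsExpandingBranch (realMap T) (minSlope T d) (distortion T d) (d i.castSucc) (d i.succ) where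
  lt := hT.strictMono i.castSucc_lt_succ
  le_deriv x hx := hT.minSlope_le_deriv (hT.Ioo_subset_regularSet i hx)
  lipschitz x hx y hy hxy := by
    obtain ⟨M, hM⟩ := hT.exists_bound
    have hpos : ∀ z ∈ Ioo (d i.castSucc) (d i.succ), deriv (realMap T) z ≠ 0 := fun z hz =>
      (one_pos.trans (hT.expanding.trans_le
        (hT.minSlope_le_deriv (hT.Ioo_subset_regularSet i hz)))).ne'
    have hder : ∀ z ∈ Ioo (d i.castSucc) (d i.succ), HasDerivAt (fun z => 1 / deriv (realMap T) z)
        (-(deriv (deriv (realMap T)) z / (deriv (realMap T) z) ^ 2)) z := fun z hz => by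
      have := (hM z (hT.Ioo_subset_regularSet i hz)).1.hasDerivAt.inv (hpos z hz)
      simpa [neg_div, Pi.inv_def] using this
    have := (convex_Ioo (d i.castSucc) (d i.succ)).norm_image_sub_le_of_norm_deriv_le
      (f := fun z => 1 / deriv (realMap T) z) (C := distortion T d)
      (fun z hz => (hder z hz).differentiableAt) (fun z hz => by
        rw [(hder z hz).deriv, norm_neg]
        exact hT.abs_div_le_distortion (hT.Ioo_subset_regularSet i hz)) hx hy
    rwa [Real.norm_eq_abs, Real.norm_eq_abs, abs_of_nonneg (sub_nonneg.2 hxy)] at this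

theorem hasExpandingBranches (hT : IsPiecewiseExpanding T d) :
    HasExpandingBranches (realMap T) d (minSlope T d) (distortion T d) where
  measurable := measurable_subtype_coe.comp
    (hT.nonsingular.measurable.comp continuous_projIcc.measurable)
  mapsTo _ _ := (T _).2
  strictMono := hT.strictMono
  first := hT.first
  last := hT.last
  branch := hT.isExpandingBranch

theorem iInf_length_pos (hT : IsPiecewiseExpanding T d) :
    0 < ⨅ i : Fin n, (d i.succ - d i.castSucc) := by
  have := hT.neZero
  obtain ⟨i, hi⟩ := exists_eq_ciInf_of_finite (f := fun i : Fin n => d i.succ - d i.castSucc)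
  rw [← hi]
  exact sub_pos.2 (hT.strictMono i.castSucc_lt_succ)

/-- The constant of the Lasota–Yorke inequality is at most `B`. The `C²` extensions of the branches
bound `T'` from above, so that the infimum of `1 / T'` lies in `(0, 1]`. -/
theorem distortion_add_le_lasotaYorkeConst (hT : IsPiecewiseExpanding T d) :
    distortion T d + 2 / (minSlope T d * ⨅ i : Fin n, (d i.succ - d i.castSucc)) ≤
      lasotaYorkeConst T d := by
  have := hT.neZero
  have hδ := hT.iInf_length_pos
  obtain ⟨M, hM⟩ := hT.exists_bound
  obtain ⟨x, hx⟩ := exists_between (hT.strictMono (0 : Fin n).castSucc_lt_succ)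
  have hx := hT.Ioo_subset_regularSet 0 hx
  have h1 : ∀ y ∈ regularSet d, 1 ≤ deriv (realMap T) y := fun y hy =>
    hT.expanding.le.trans (hT.minSlope_le_deriv hy)
  have hM0 : 0 < M := one_pos.trans_le ((h1 x hx).trans ((le_abs_self _).trans (hM x hx).2.1))
  have hlow : ∀ q ∈ (fun x => 1 / deriv (realMap T) x) '' regularSet d, 1 / M ≤ q := by
    rintro _ ⟨y, hy, rfl⟩
    exact one_div_le_one_div_of_le (one_pos.trans_le (h1 y hy))
      ((le_abs_self _).trans (hM y hy).2.1)
  have hq0 : 0 < sInf ((fun x => 1 / deriv (realMap T) x) '' regularSet d) :=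
    (one_div_pos.2 hM0).trans_le (le_csInf ⟨_, x, hx, rfl⟩ hlow)
  have hq1 : sInf ((fun x => 1 / deriv (realMap T) x) '' regularSet d) ≤ 1 :=
    (csInf_le ⟨_, hlow⟩ ⟨x, hx, rfl⟩).trans
      (by simpa using inv_le_one_of_one_le₀ (h1 x hx))
  refine add_le_add (le_div_self distortion_nonneg hq0 hq1) ?_
  exact div_le_div_of_nonneg_left zero_le_two hδ (le_mul_of_one_le_left hδ.le hT.expanding.le)

end IsPiecewiseExpanding

/-! ### From `L¹` approximation to total variation -/

/-- Lower semicontinuity of the variation: an `L¹` limit of functions whose variation is bounded by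
`c k → C` has a representative whose variation is at most `C`. -/
theorem exists_ae_eq_dominatedOn_of_tendsto {f : I → ℝ} (hf : Integrable f) {h w : ℕ → ℝ → ℝ}
    {c : ℕ → ℝ} {C : ℝ} (hC0 : 0 ≤ C) (hw : ∀ k, DominatedOn (h k) (w k) (Icc 0 1))
    (hwc : ∀ k, w k 1 - w k 0 ≤ c k) (hc : Tendsto c atTop (𝓝 C))
    (hlim : Tendsto (fun k => ∫ x : I, |h k x - f x|) atTop (𝓝 0)) :
    ∃ g v : I → ℝ, g =ᵐ[volume] f ∧ DominatedOn g v univ ∧ ∀ x, 0 ≤ v x ∧ v x ≤ C := by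
  have hint : ∀ k, Integrable (fun x : I => h k x) := fun k =>
    (integrableOn_iff_comap_subtypeVal measurableSet_Icc).1
      ((hw k).integrableOn_Icc zero_le_one)
  have hmeas : TendstoInMeasure volume (fun k (x : I) => h k x) atTop f := by
    refine tendstoInMeasure_of_tendsto_eLpNorm one_ne_zero (fun k => (hint k).1) hf.1 ?_
    have h1 : ∀ k, eLpNorm ((fun x : I => h k x) - f) 1 volume =
        ENNReal.ofReal (∫ x : I, |h k x - f x|) := fun k => by
      rw [eLpNorm_one_eq_lintegral_enorm,
        ← ofReal_integral_norm_eq_lintegral_enorm ((hint k).sub hf)]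
      rfl
    simp only [h1]
    simpa using ENNReal.tendsto_ofReal hlim
  obtain ⟨ns, hns, hae⟩ := hmeas.exists_seq_tendsto_ae
  have hvar : ∀ k, eVariationOn (fun x : I => h k x) univ ≤ ENNReal.ofReal (c k) := fun k => by
    have hd : DominatedOn (fun x : I => h k x) (fun x : I => w k x) univ :=
      fun x _ y _ hxy => hw k x x.2 y y.2 hxy
    refine (hd.eVariationOn_le (A := w k 0) (B := w k 1) (fun x _ => ?_) fun x _ => ?_).trans
      (ENNReal.ofReal_le_ofReal (hwc k))
    · exact (hw k).monotoneOn (left_mem_Icc.2 zero_le_one) x.2 x.2.1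
    · exact (hw k).monotoneOn x.2 (right_mem_Icc.2 zero_le_one) x.2.2
  have hE : eVariationOn f {x | Tendsto (fun i => h (ns i) x) atTop (𝓝 (f x))} ≤
      ENNReal.ofReal C := by
    refine le_of_forall_lt fun v hv => ?_
    obtain ⟨u, hvu, hu⟩ := exists_between hv
    have h1 := eVariationOn.lowerSemicontinuous_aux
      (F := fun i (x : I) => h (ns i) x) (p := atTop) (fun x hx => hx) hu
    exact hvu.trans_le (ge_of_tendsto
      (ENNReal.tendsto_ofReal (hc.comp hns.tendsto_atTop)) (h1.mono fun i hi =>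
        hi.le.trans ((eVariationOn.mono _ (subset_univ _)).trans (hvar (ns i)))))
  obtain ⟨g, v, hgf, hgv, hv⟩ := exists_dominatedOn_univ_of_eVariationOn_le hC0 hE
  refine ⟨g, v, ?_, hgv, hv⟩
  filter_upwards [hae] with x hx using hgf hx

theorem totalVariation_le_of_dominatedOn {f g v : I → ℝ} {C : ℝ} (hgf : g =ᵐ[volume] f)
    (hg : DominatedOn g v univ) (hv : ∀ x, 0 ≤ v x ∧ v x ≤ C) :
    totalVariation f ≤ ENNReal.ofReal C := by
  refine (iInf₂_le g hgf).trans ?_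
  simpa using hg.eVariationOn_le (A := 0) (B := C) (fun x _ => (hv x).1) fun x _ => (hv x).2

/-- A probability density exceeds its mean `1` by at most its variation. -/
theorem eLpNorm_top_le_of_dominatedOn {f g v : I → ℝ} {C : ℝ} (hf : Integrable f)
    (hf0 : 0 ≤ᵐ[volume] f) (hf1 : ∫ x, f x = 1) (hgf : g =ᵐ[volume] f)
    (hg : DominatedOn g v univ) (hv : ∀ x, 0 ≤ v x ∧ v x ≤ C) :
    eLpNorm f ∞ volume ≤ ENNReal.ofReal (C + 1) := by
  have hosc : ∀ x y, g x ≤ C + g y := fun x y => by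
    rcases le_total x y with h | h
    · have := abs_le.1 (hg x (mem_univ x) y (mem_univ y) h)
      linarith [(hv x).1, (hv y).2]
    · have := abs_le.1 (hg y (mem_univ y) x (mem_univ x) h)
      linarith [(hv y).1, (hv x).2]
  have hgi : Integrable g := hf.congr hgf.symm
  have hbound : ∀ x, g x ≤ C + 1 := fun x => by
    have h1 : ∫ _ : I, g x ≤ ∫ y : I, (C + g y) :=
      integral_mono (integrable_const _) ((integrable_const _).add hgi) fun y => hosc x y
    rw [integral_add (integrable_const _) hgi, integral_congr_ae hgf, hf1] at h1
    simpa using h1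
  rw [eLpNorm_exponent_top]
  refine eLpNormEssSup_le_of_ae_bound ?_
  filter_upwards [hgf, hf0] with x hx h0
  rw [Real.norm_eq_abs, abs_of_nonneg h0, ← hx]
  exact hbound x

/-! ### Invariant densities -/

theorem IsDensity.integral_eq {f : I → ℝ} {μ : Measure I} (hf : IsDensity f μ) (φ : I → ℝ) :
    ∫ x, φ x ∂μ = ∫ x, f x * φ x := by
  rw [hf.eq_withDensity, integral_withDensity_eq_integral_toReal_smul₀
    hf.integrable.1.aemeasurable.ennreal_ofReal
    (Eventually.of_forall fun x => ENNReal.ofReal_lt_top)]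
  refine integral_congr_ae ?_
  filter_upwards [hf.nonneg] with x hx
  simp [ENNReal.toReal_ofReal hx]

theorem intervalIntegral_eq_integral_unitInterval (F : ℝ → ℝ) :
    ∫ x in (0 : ℝ)..1, F x = ∫ x : I, F x := by
  rw [intervalIntegral.integral_of_le zero_le_one, ← integral_Icc_eq_integral_Ioc]
  exact (integral_subtype measurableSet_Icc F).symm

end PiecewiseExpanding

open PiecewiseExpanding in
theorem mainTheorem6 {n : ℕ} (T : I → I) (d : Fin (n + 1) → ℝ)
    (hT : PiecewiseExpanding.IsPiecewiseExpanding T d)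
    (hslope : 2 < PiecewiseExpanding.minSlope T d)
    (μ : Measure I) (hμ : PiecewiseExpanding.IsPhysicalMeasure T μ)
    (f : I → ℝ) (hf : PiecewiseExpanding.IsDensity f μ) :
    PiecewiseExpanding.totalVariation f ≤
        ENNReal.ofReal (PiecewiseExpanding.lasotaYorkeConst T d /
          (1 - 2 / PiecewiseExpanding.minSlope T d)) ∧
      eLpNorm f ∞ volume ≤
        ENNReal.ofReal (PiecewiseExpanding.lasotaYorkeConst T d /
          (1 - 2 / PiecewiseExpanding.minSlope T d) + 1) := by
  have := hμ.isProbabilityMeasure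
  have H := hT.hasExpandingBranches
  have hδ := hT.iInf_length_pos
  have hl0 := two_pos.trans hslope
  have ha : 0 < 1 - 2 / minSlope T d := sub_pos.2 ((div_lt_one hl0).2 hslope)
  have hD := distortion_nonneg (T := T) (d := d)
  set δ := ⨅ i : Fin n, (d i.succ - d i.castSucc) with hδdef
  set B' := distortion T d + 2 / (minSlope T d * δ) with hB'
  have hB'0 : 0 ≤ B' := by positivity
  have hCle : B' / (1 - 2 / minSlope T d) ≤
      lasotaYorkeConst T d / (1 - 2 / minSlope T d) :=
    div_le_div_of_nonneg_right hT.distortion_add_le_lasotaYorkeConst ha.le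
  have hf1 : ∫ x, f x = 1 := by
    have := hf.integral_eq fun _ => 1
    simpa using this.symm
  -- `F` extends `f` to the line, where the transfer operator is defined
  set F : ℝ → ℝ := fun x => f (projIcc 0 1 zero_le_one x) with hF
  have hFv : ∀ x : I, F x = f x := fun x => by rw [hF]; simp only [projIcc_val]
  have hFi : IntegrableOn F (Icc 0 1) := by
    refine (integrableOn_iff_comap_subtypeVal measurableSet_Icc).2 ?_
    exact hf.integrable.congr (Eventually.of_forall fun x => (hFv x).symm)
  have hF1 : ∫ x in (0 : ℝ)..1, |F x| = 1 := by
    rw [intervalIntegral_eq_integral_unitInterval, ← hf1]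
    refine integral_congr_ae ?_
    filter_upwards [hf.nonneg] with x hx
    rw [hFv, abs_of_nonneg hx]
  -- invariance of `μ` says that `F` is a fixed point of the transfer operator in the weak sense
  have hinv : ∀ ψ : ℝ → ℝ, Measurable ψ → (∀ x, |ψ x| ≤ 1) →
      ∫ x in (0 : ℝ)..1, F x * ψ (realMap T x) = ∫ x in (0 : ℝ)..1, F x * ψ x := by
    intro ψ hψ _
    have hψI : Measurable fun x : I => ψ x := hψ.comp measurable_subtype_coe
    rw [intervalIntegral_eq_integral_unitInterval, intervalIntegral_eq_integral_unitInterval]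
    simp only [hFv, realMap, projIcc_val]
    rw [← hf.integral_eq fun x => ψ (T x), ← hf.integral_eq fun x => ψ x]
    conv_rhs => rw [← hμ.invariant.map_eq]
    exact (integral_map hμ.invariant.measurable.aemeasurable hψI.aestronglyMeasurable).symm
  have hε : ∀ k : ℕ, (0 : ℝ) < 1 / (k + 1) := fun k => Nat.one_div_pos_of_nat
  choose h w hw hhF hwc using fun k : ℕ => H.exists_dominatedOn_near hslope hδ
    (fun i => ciInf_le (finite_range _).bddBelow i) hFi hF1 hD hinv (hε k)
  have hε0 := tendsto_one_div_add_atTop_nhds_zero_nat (𝕜 := ℝ)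
  obtain ⟨g, v, hgf, hgv, hv⟩ := exists_ae_eq_dominatedOn_of_tendsto hf.integrable
    (C := B' / (1 - 2 / minSlope T d)) (by positivity) hw hwc
    (by simpa using hε0.add (((hε0.const_add 1).const_mul B').div_const _)) (by
      refine squeeze_zero (fun k => integral_nonneg fun x => abs_nonneg _) (fun k => ?_) hε0
      have := hhF k
      rw [intervalIntegral_eq_integral_unitInterval] at this
      simpa only [hFv] using this)
  exact ⟨(totalVariation_le_of_dominatedOn hgf hgv hv).trans (ENNReal.ofReal_le_ofReal hCle),
    (eLpNorm_top_le_of_dominatedOn hf.integrable hf.nonneg hf1 hgf hgv hv).trans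
      (ENNReal.ofReal_le_ofReal (by linarith))⟩
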